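/- For complex parameters with no $b_j\in\{0,-1,-2,\dots\}$ and $p\le q$ let $${}_pF_q(a_1,\dots,a_p;b_1,\dots,b_q;z)=\sum_{n=0}^\infty\frac{(a_1)_n\cdots(a_p)_n}{(b_1)_n\cdots(b_q)_n}\,\frac{z^n}{n!},$$ where $(x)_n=x(x+1)\cdots(x+n-1)$, and let $${}_p\tilde F_q(a_1,\dots,a_p;b_1,\dots,b_q;z)=\sum_{n=0}^\infty\frac{(a_1)_n\cdots(a_p)_n}{\Gamma(b_1+n)\cdots\Gamma(b_q+n)}\,\frac{z^n}{n!}$$ be the regularized function, so that ${}_pF_q=\Gamma(b_1)\cdots\Gamma(b_q)\,{}_p\tilde F_q$. For every odd integer $L\ge 1$ put $$c_L=\frac{\pi}{4}\,(2\cdot 1+1)\,\frac{(-1)^{L-1}\,i^{2L-2}\,2^{2-4L}\,\bigl(1+(-1)^{L+1}\bigr)^2}{2L+1}=\frac{3\pi\,2^{2-4L}}{2L+1}.$$ Then, for every $z\in\mathbb{C}$, $${}_2F_3\left(\tfrac12,\tfrac32;1,1,\tfrac52;z\right)=\sum_{L\ge 1,\ L\text{ odd}}c_L\,z^{L-1}\left(\frac{L+1}{16\,\Gamma\left(\frac{2L+5}{2}\right)}\binom{L+1}{\frac{L+1}{2}}\,z\;{}_1F_2\left(\tfrac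 L2+1;\tfrac L2+\tfrac32,L+\tfrac52;\tfrac z4\right)+\frac{L}{\Gamma\left(\frac{2L+1}{2}\right)}\binom{L-1}{\frac{L-1}{2}}\;{}_1F_2\left(\tfrac L2;\tfrac L2+\tfrac12,L+\tfrac12;\tfrac z4\right)\right)^2$$ and also $${}_2F_3\left(\tfrac12,\tfrac32;1,1,\tfrac52;z\right)=\sum_{L\ge 1,\ L\text{ odd}}c_L\,z^{L-1}\left(\frac{(L+1)\,\Gamma(L+2)}{16\,\Gamma\left(\frac L2+\frac32\right)}\,z\;{}_1\tilde F_2\left(\tfrac L2+1;L+\tfrac52,\tfrac L2+\tfrac32;\tfrac z4\right)+\frac{\Gamma(L+1)}{\Gamma\left(\frac L2+\frac12\right)}\;{}_1\tilde F_2\left(\tfrac L2;L+\tfrac12,\tfrac L2+\tfrac12;\tfrac z4\right)\right)^2,$$ both series being absolutely convergent. (Here $z^0=1$, also at $z=0$.) -/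

import Mathlib

/-- The generalized hypergeometric function `pFq(a; b; z)`, given by the power series
`∑ₙ (∏ᵢ (aᵢ)ₙ / ∏ⱼ (bⱼ)ₙ) zⁿ / n!`, where `(x)ₙ` is the rising factorial. The parameter lists
are multisets, so repeated parameters are counted with multiplicity. For `p ≤ q` and `bⱼ` not
in `{0, -1, -2, …}` the series converges absolutely for every complex `z`. -/
noncomputable def pFq (a b : Multiset ℂ) (z : ℂ) : ℂ :=
  ∑' n : ℕ, (a.map (ascPochhammer ℂ n).eval).prod / (b.map (ascPochhammer ℂ n).eval).prod
    * z ^ n / (n.factorial : ℂ)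

/-!
The powers `xᵐ` on `(0, 1)` with weight `x^(c-1)` have inner products `1 / (m + n + c)`. Expanding
them in the orthogonal Jacobi polynomials `P_l^(0, c-1)(2x - 1)`, whose moments `M_l(m)` against
`xᵐ` have a closed form, and applying Parseval's identity to a function `u(x) = ∑ uₘ xᵐ` gives
`∑ uₘ uₙ / (m + n + c) = ∑_l (2l + c) (∑ₘ uₘ M_l(m))²`. The sums over `l` telescope, so neither
integrals nor polynomials are needed. If `u` is a hypergeometric function of `t x`, its moments are
hypergeometric functions of `t`. For the Bessel series `∑ (t x)ᵐ / m!²` and `c = 3/2` the left side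
is the `₂F₃` of the theorem and each Legendre coefficient is a multiple of a single `₁F₂`, which a
contiguous relation splits into the two that appear in the statement.
-/

open Complex (regularizedHGFun regularizedHGFunCoeff)
open Finset.HasAntidiagonal (antidiagonal)
open scoped Nat

section JacobiMoment

/-- The moment `∫₀¹ x^(m+c-1) P(2x - 1) dx` of the Jacobi polynomial `P = P_l^(0, c-1)`, defined
through its closed form. For `c = 3/2` it is `∫₀¹ y^(2m+1) P(y) dy`, up to a factor `2`, for the
Legendre polynomial `P` of degree `2l + 1`. -/
noncomputable def jacobiMoment (c : ℝ) (l m : ℕ) : ℝ :=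
  m.descFactorial l * Real.Gamma (m + c) / Real.Gamma (m + l + c + 1)

variable {c : ℝ}

theorem jacobiMoment_nonneg (hc : 0 < c) (l m : ℕ) : 0 ≤ jacobiMoment c l m := by
  unfold jacobiMoment
  positivity

theorem jacobiMoment_eq_zero_of_lt (c : ℝ) {l m : ℕ} (h : m < l) : jacobiMoment c l m = 0 := by
  simp [jacobiMoment, Nat.descFactorial_of_lt h]

theorem jacobiMoment_zero_left (hc : 0 < c) (m : ℕ) : jacobiMoment c 0 m = 1 / (m + c) := by
  have hG : Real.Gamma (m + c) ≠ 0 := (Real.Gamma_pos_of_pos (by positivity)).ne'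
  have hm : (m : ℝ) + c ≠ 0 := by positivity
  simp only [jacobiMoment, Nat.descFactorial_zero, Nat.cast_one, one_mul, Nat.cast_zero, add_zero]
  rw [Real.Gamma_add_one hm]
  field_simp

theorem cast_descFactorial_succ {R : Type*} [Ring R] (m l : ℕ) :
    (m.descFactorial (l + 1) : R) = (m - l) * m.descFactorial l := by
  rcases le_or_gt l m with h | h
  · rw [Nat.descFactorial_succ, Nat.cast_mul, Nat.cast_sub h]
  · simp [Nat.descFactorial_of_lt h]

theorem add_mul_jacobiMoment_succ (hc : 0 < c) (l m : ℕ) :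
    (m + (l + 1 : ℕ) + c) * jacobiMoment c (l + 1) m = (m - l) * jacobiMoment c l m := by
  have hx : (m : ℝ) + l + c + 1 ≠ 0 := by positivity
  have hG : Real.Gamma (m + l + c + 1) ≠ 0 := (Real.Gamma_pos_of_pos (by positivity)).ne'
  rw [jacobiMoment, jacobiMoment, cast_descFactorial_succ, Nat.cast_succ,
    show (m : ℝ) + (l + 1) + c = m + l + c + 1 by ring, Real.Gamma_add_one hx]
  field_simp

theorem sum_range_jacobiMoment_mul (hc : 0 < c) (m n N : ℕ) :
    ∑ l ∈ Finset.range N, (2 * l + c) * (jacobiMoment c l m * jacobiMoment c l n) =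
      (1 - (m + N + c) * jacobiMoment c N m * ((n + N + c) * jacobiMoment c N n)) /
        (m + n + c) := by
  have hmn : (m : ℝ) + n + c ≠ 0 := by positivity
  induction N with
  | zero =>
    have hm : (m : ℝ) + c ≠ 0 := by positivity
    have hn : (n : ℝ) + c ≠ 0 := by positivity
    simp [jacobiMoment_zero_left hc, hm, hn]
  | succ N ih =>
    rw [Finset.sum_range_succ, ih, add_mul_jacobiMoment_succ hc, add_mul_jacobiMoment_succ hc]
    field_simp
    ring

theorem hasSum_jacobiMoment_mul (hc : 0 < c) (m n : ℕ) :
    HasSum (fun l : ℕ ↦ (2 * l + c) * (jacobiMoment c l m * jacobiMoment c l n))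
      (1 / (m + n + c)) := by
  have hzero : ∀ l ∉ Finset.range (m + 1),
      (2 * l + c) * (jacobiMoment c l m * jacobiMoment c l n) = 0 := fun l hl ↦ by
    rw [jacobiMoment_eq_zero_of_lt c (by simpa using hl), zero_mul, mul_zero]
  have h : HasSum _ _ := hasSum_sum_of_ne_finset_zero hzero
  rwa [sum_range_jacobiMoment_mul hc, jacobiMoment_eq_zero_of_lt c m.lt_succ_self, mul_zero,
    zero_mul, sub_zero] at h

theorem jacobiMoment_le (hc : 0 < c) (l m : ℕ) : jacobiMoment c l m ≤ 1 / c := by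
  have hnonneg (k : ℕ) : 0 ≤ jacobiMoment c k m := jacobiMoment_nonneg hc k m
  have hsq : c * jacobiMoment c l m ^ 2 ≤ 1 / c := calc
    c * jacobiMoment c l m ^ 2
    _ ≤ (2 * l + c) * (jacobiMoment c l m * jacobiMoment c l m) := by
        rw [← sq]
        gcongr
        linarith [l.cast_nonneg (α := ℝ)]
    _ ≤ 1 / (m + m + c) :=
        le_hasSum (hasSum_jacobiMoment_mul hc m m) l fun k _ ↦ by have := hnonneg k; positivity
    _ ≤ 1 / c := by gcongr; linarith [m.cast_nonneg (α := ℝ)]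
  refine (sq_le_sq₀ (hnonneg l) (by positivity)).1 ?_
  calc jacobiMoment c l m ^ 2
    _ = c * jacobiMoment c l m ^ 2 / c := by field_simp
    _ ≤ 1 / c / c := by gcongr
    _ = (1 / c) ^ 2 := by ring

end JacobiMoment

section Parseval

variable {c : ℝ} {u v : ℕ → ℂ}

theorem summable_mul_jacobiMoment (hc : 0 < c) (hu : Summable u) (l : ℕ) :
    Summable fun m ↦ u m * jacobiMoment c l m := by
  refine Summable.of_norm_bounded (hu.norm.mul_right (1 / c)) fun m ↦ ?_
  rw [norm_mul, Complex.norm_real, Real.norm_of_nonneg (jacobiMoment_nonneg hc l m)]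
  gcongr
  exact jacobiMoment_le hc l m

theorem summable_mul_mul_jacobiMoment_mul (hc : 0 < c) (hu : Summable u) (hv : Summable v) :
    Summable fun q : (ℕ × ℕ) × ℕ ↦ u q.1.1 * v q.1.2 *
      ((2 * q.2 + c) * (jacobiMoment c q.2 q.1.1 * jacobiMoment c q.2 q.1.2) : ℝ) := by
  have hnorm (p : ℕ × ℕ) (l : ℕ) :
      ‖u p.1 * v p.2 * ((2 * l + c) * (jacobiMoment c l p.1 * jacobiMoment c l p.2) : ℝ)‖ =
        ‖u p.1‖ * ‖v p.2‖ * ((2 * l + c) * (jacobiMoment c l p.1 * jacobiMoment c l p.2)) := by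
    have h₁ := jacobiMoment_nonneg hc l p.1
    have h₂ := jacobiMoment_nonneg hc l p.2
    rw [norm_mul, norm_mul, Complex.norm_real, Real.norm_of_nonneg (by positivity)]
  have hrow (p : ℕ × ℕ) :=
    (hasSum_jacobiMoment_mul hc p.1 p.2).mul_left (‖u p.1‖ * ‖v p.2‖)
  refine Summable.of_norm ((summable_prod_of_nonneg fun _ ↦ norm_nonneg _).2 ?_)
  simp only [hnorm, (hrow _).tsum_eq]
  refine ⟨fun p ↦ (hrow p).summable, ?_⟩
  refine Summable.of_nonneg_of_le (fun p ↦ by positivity) (fun p ↦ ?_)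
    ((hu.norm.mul_of_nonneg hv.norm (fun _ ↦ norm_nonneg _)
      fun _ ↦ norm_nonneg _).mul_right (1 / c))
  gcongr
  linarith [p.1.cast_nonneg (α := ℝ), p.2.cast_nonneg (α := ℝ)]

theorem hasSum_tsum_mul_jacobiMoment_mul_tsum (hc : 0 < c) (hu : Summable u) (hv : Summable v) :
    HasSum (fun l : ℕ ↦ (2 * l + c : ℂ) *
        ((∑' m, u m * jacobiMoment c l m) * ∑' n, v n * jacobiMoment c l n))
      (∑' n : ℕ, (∑ p ∈ antidiagonal n, u p.1 * v p.2) / (n + c)) := by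
  have hsum := summable_mul_mul_jacobiMoment_mul hc hu hv
  have hrow (p : ℕ × ℕ) := (Complex.hasSum_ofReal.2
    (hasSum_jacobiMoment_mul hc p.1 p.2)).mul_left (u p.1 * v p.2)
  have hpairs := hsum.hasSum.prod_fiberwise hrow
  have hdiag := (Finset.HasAntidiagonal.sigmaAntidiagonalEquivProd.hasSum_iff.2 hpairs).sigma
    fun n ↦ hasSum_fintype _
  have hcol (l : ℕ) := ((summable_mul_of_summable_norm
    (summable_mul_jacobiMoment hc hu l).norm
    (summable_mul_jacobiMoment hc hv l).norm).hasSum).mul_left (2 * l + c : ℂ)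
  simp only [← tsum_mul_tsum_of_summable_norm (summable_mul_jacobiMoment hc hu _).norm
    (summable_mul_jacobiMoment hc hv _).norm] at hcol
  convert! ((Equiv.prodComm ℕ (ℕ × ℕ)).hasSum_iff.2 hsum.hasSum).prod_fiberwise fun l ↦ ?_ using 1
  · rw [← hdiag.tsum_eq]
    refine tsum_congr fun n ↦ ?_
    rw [Finset.sum_div, ← Finset.sum_coe_sort (antidiagonal n)]
    refine Finset.sum_congr rfl fun p _ ↦ ?_
    have hp : (p.1.1 : ℂ) + p.1.2 = n := by
      exact_mod_cast Finset.HasAntidiagonal.mem_antidiagonal.1 p.2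
    simp [← hp, div_eq_mul_inv]
  · convert! hcol l using 2 with p
    simp only [Function.comp_apply, Equiv.prodComm_apply, Prod.swap]
    push_cast
    ring

end Parseval

section Pochhammer

theorem ascPochhammer_eval_add {R : Type*} [CommSemiring R] (a : R) (m n : ℕ) :
    (ascPochhammer R (m + n)).eval a =
      (ascPochhammer R m).eval a * (ascPochhammer R n).eval (a + m) := by
  simp [← ascPochhammer_mul]

theorem ascPochhammer_eval_mul_add_natCast {R : Type*} [CommSemiring R] (a : R) (n : ℕ) :
    (ascPochhammer R n).eval a * (a + n) = a * (ascPochhammer R n).eval (a + 1) := by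
  rw [← ascPochhammer_succ_eval, add_comm n 1, ascPochhammer_eval_add]
  simp

theorem ascPochhammer_eval_one_half {K : Type*} [Field K] [CharZero K] (n : ℕ) :
    (ascPochhammer K n).eval (1 / 2) = n.centralBinom * n ! / 4 ^ n := by
  induction n with
  | zero => simp
  | succ n ih =>
    have h : ((n : K) + 1) * (n + 1).centralBinom = 2 * (2 * n + 1) * n.centralBinom :=
      mod_cast n.succ_mul_centralBinom_succ
    rw [ascPochhammer_succ_eval, ih, Nat.factorial_succ, pow_succ]
    push_cast
    field_simp
    linear_combination (-2 * (n ! : K)) * h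

theorem ofReal_ne_neg_natCast {x : ℝ} (hx : 0 < x) (k : ℕ) : (x : ℂ) ≠ -k := by
  have h : x ≠ -k := ((neg_nonpos.2 k.cast_nonneg).trans_lt hx).ne'
  exact_mod_cast h

theorem ascPochhammer_eval_mul_Gamma {s : ℂ} (hs : ∀ k : ℕ, s ≠ -k) (n : ℕ) :
    (ascPochhammer ℂ n).eval s * Complex.Gamma s = Complex.Gamma (s + n) := by
  rw [← Complex.Gamma_add_nat_div_Gamma_eq s hs, div_mul_cancel₀ _ (Complex.Gamma_ne_zero hs)]

end Pochhammer

section RegularizedHypergeometric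

theorem regularizedHGFunCoeff_cons_cons (a b : ℂ) (as bs : Multiset ℂ) (n : ℕ) :
    regularizedHGFunCoeff (a ::ₘ as) (b ::ₘ bs) n =
      (ascPochhammer ℂ n).eval a / Complex.Gamma (b + n) * regularizedHGFunCoeff as bs n := by
  simp only [regularizedHGFunCoeff, Multiset.map_cons, Multiset.prod_cons]
  rw [div_mul_div_comm, mul_left_comm]

theorem factorial_mul_regularizedHGFunCoeff_add (as bs : Multiset ℂ) (k l : ℕ) :
    (k + l)! * regularizedHGFunCoeff as bs (k + l) =
      k ! * ((as.map (ascPochhammer ℂ l).eval).prod *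
        regularizedHGFunCoeff (as.map (· + (l : ℂ))) (bs.map (· + (l : ℂ))) k) := by
  have hkl : ((k + l)! : ℂ) ≠ 0 := mod_cast (k + l).factorial_ne_zero
  have hk : (k ! : ℂ) ≠ 0 := mod_cast k.factorial_ne_zero
  have hb : (bs.map fun b ↦ Complex.Gamma (b + (k + l : ℕ))) =
      bs.map fun b ↦ Complex.Gamma (b + l + k) := by
    simp only [Nat.cast_add, add_comm (k : ℂ), add_assoc]
  have ha : (as.map (ascPochhammer ℂ (k + l)).eval).prod = (as.map (ascPochhammer ℂ l).eval).prod *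
      (as.map fun a : ℂ ↦ (ascPochhammer ℂ k).eval (a + l)).prod := by
    simp only [add_comm k l, ascPochhammer_eval_add, Multiset.prod_map_mul]
  simp only [regularizedHGFunCoeff, Multiset.map_map, Function.comp_def, hb, ha]
  field_simp

theorem hasSum_regularizedHGFun {as bs : Multiset ℂ} (h : as.card ≤ bs.card) (t : ℂ) :
    HasSum (fun n ↦ regularizedHGFunCoeff as bs n * t ^ n) (regularizedHGFun as bs t) := by
  have hr := Complex.radius_regularizedHGFunSeries_eq_top h
  have hs := (Complex.regularizedHGFunSeries as bs).hasSum (x := t) (by simp [hr])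
  convert! hs using 2 with n
  simp [Complex.regularizedHGFunSeries, mul_comm]

theorem pFq_eq_prod_Gamma_mul_regularizedHGFun (as : Multiset ℂ) {bs : Multiset ℂ}
    (hbs : ∀ b ∈ bs, ∀ k : ℕ, b ≠ -k) (t : ℂ) :
    pFq as bs t = (bs.map Complex.Gamma).prod * regularizedHGFun as bs t := by
  rw [regularizedHGFun, Complex.regularizedHGFunSeries,
    ← FormalMultilinearSeries.ofScalarsSum, FormalMultilinearSeries.ofScalars_sum_eq,
    ← tsum_mul_left, pFq]
  refine tsum_congr fun n ↦ ?_
  have hshift : (bs.map fun b ↦ Complex.Gamma (b + n)).prod =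
      (bs.map (ascPochhammer ℂ n).eval).prod * (bs.map Complex.Gamma).prod := by
    rw [← Multiset.prod_map_mul]
    exact congrArg Multiset.prod (Multiset.map_congr rfl fun b hb ↦
      (ascPochhammer_eval_mul_Gamma (hbs b hb) n).symm)
  have hne : (bs.map Complex.Gamma).prod ≠ 0 := by
    refine Multiset.prod_ne_zero fun h0 ↦ ?_
    obtain ⟨b, hb, hb0⟩ := Multiset.mem_map.1 h0
    exact Complex.Gamma_ne_zero (hbs b hb) hb0
  rw [regularizedHGFunCoeff, hshift, smul_eq_mul]
  field_simp

theorem regularizedHGFunCoeff_contiguous (a d : ℂ) (as bs : Multiset ℂ) (k : ℕ) :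
    d * regularizedHGFunCoeff ((a + 1) ::ₘ as) ((d + 1) ::ₘ bs) (k + 1) -
        regularizedHGFunCoeff (a ::ₘ as) (d ::ₘ bs) (k + 1) =
      (d - a) * as.prod * regularizedHGFunCoeff ((a + 1) ::ₘ as.map (· + 1))
        ((d + 2) ::ₘ bs.map (· + 1)) k := by
  have hk : (k ! : ℂ) ≠ 0 := mod_cast k.factorial_ne_zero
  have hshift : (k + 1) * regularizedHGFunCoeff as bs (k + 1) =
      as.prod * regularizedHGFunCoeff (as.map (· + 1)) (bs.map (· + 1)) k := by
    have h := factorial_mul_regularizedHGFunCoeff_add as bs k 1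
    simp only [Nat.factorial_succ, ascPochhammer_one, Polynomial.eval_X, Nat.cast_one,
      Multiset.map_id'] at h
    refine mul_left_cancel₀ hk ?_
    rw [← h]
    push_cast
    ring
  have hGamma : (Complex.Gamma (d + (k + 1 : ℕ)))⁻¹ =
      (d + k + 1) * (Complex.Gamma (d + 2 + k))⁻¹ := by
    rw [Complex.one_div_Gamma_eq_self_mul_one_div_Gamma_add_one,
      show d + (k + 1 : ℕ) = d + k + 1 by push_cast; ring,
      show d + k + 1 + 1 = d + 2 + k by ring]
  have hpoch : (ascPochhammer ℂ (k + 1)).eval a = a * (ascPochhammer ℂ k).eval (a + 1) := by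
    rw [ascPochhammer_succ_eval, ascPochhammer_eval_mul_add_natCast]
  simp only [regularizedHGFunCoeff_cons_cons, div_eq_mul_inv, hGamma]
  rw [hpoch, ascPochhammer_succ_eval, show d + 1 + (k + 1 : ℕ) = d + 2 + k by push_cast; ring]
  linear_combination (d - a) * (ascPochhammer ℂ k).eval (a + 1) *
    (Complex.Gamma (d + 2 + k))⁻¹ * hshift

theorem regularizedHGFun_contiguous (a d : ℂ) {as bs : Multiset ℂ} (h : as.card ≤ bs.card)
    (t : ℂ) :
    d * regularizedHGFun ((a + 1) ::ₘ as) ((d + 1) ::ₘ bs) t =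
      (d - a) * as.prod * t *
          regularizedHGFun ((a + 1) ::ₘ as.map (· + 1)) ((d + 2) ::ₘ bs.map (· + 1)) t +
        regularizedHGFun (a ::ₘ as) (d ::ₘ bs) t := by
  rw [← sub_eq_iff_eq_add]
  have hdiff := ((hasSum_regularizedHGFun (as := (a + 1) ::ₘ as) (bs := (d + 1) ::ₘ bs)
    (by simpa using h) t).mul_left d).sub
      (hasSum_regularizedHGFun (as := a ::ₘ as) (bs := d ::ₘ bs) (by simpa using h) t)
  have hshift := (hasSum_regularizedHGFun (as := (a + 1) ::ₘ as.map (· + 1))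
    (bs := (d + 2) ::ₘ bs.map (· + 1)) (by simpa using h) t).mul_left ((d - a) * as.prod * t)
  have hzero : d * regularizedHGFunCoeff ((a + 1) ::ₘ as) ((d + 1) ::ₘ bs) 0 =
      regularizedHGFunCoeff (a ::ₘ as) (d ::ₘ bs) 0 := by
    have hGamma := Complex.one_div_Gamma_eq_self_mul_one_div_Gamma_add_one d
    simp only [regularizedHGFunCoeff_cons_cons, ascPochhammer_zero, Polynomial.eval_one,
      Nat.cast_zero, add_zero, one_div, hGamma, mul_assoc]
  rw [← hasSum_nat_add_iff' 1] at hdiff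
  simp only [Finset.sum_range_one, pow_zero, mul_one, hzero, sub_self, sub_zero] at hdiff
  refine hdiff.unique ?_
  convert! hshift using 2 with k
  linear_combination t ^ (k + 1) * regularizedHGFunCoeff_contiguous a d as bs k

theorem regularizedHGFunCoeff_mul_jacobiMoment {c : ℝ} (hc : 0 < c) (as bs : Multiset ℂ)
    (l k : ℕ) :
    regularizedHGFunCoeff as bs (k + l) * jacobiMoment c l (k + l) =
      (as.map (ascPochhammer ℂ l).eval).prod * Complex.Gamma (l + c) *
        regularizedHGFunCoeff ((l + c : ℂ) ::ₘ as.map (· + (l : ℂ)))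
          ((2 * l + c + 1 : ℂ) ::ₘ bs.map (· + (l : ℂ))) k := by
  have hk : (k ! : ℂ) ≠ 0 := mod_cast k.factorial_ne_zero
  have hdesc : (k ! : ℂ) * (k + l).descFactorial l = (k + l)! := by
    have h := Nat.factorial_mul_descFactorial (Nat.le_add_left l k)
    rw [Nat.add_sub_cancel] at h
    exact mod_cast h
  have hpole : ∀ j : ℕ, (l + c : ℂ) ≠ -j :=
    mod_cast ofReal_ne_neg_natCast (x := l + c) (by positivity)
  have hcoeff : (k + l).descFactorial l * regularizedHGFunCoeff as bs (k + l) =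
      (as.map (ascPochhammer ℂ l).eval).prod *
        regularizedHGFunCoeff (as.map (· + (l : ℂ))) (bs.map (· + (l : ℂ))) k := by
    refine mul_left_cancel₀ hk ?_
    rw [← factorial_mul_regularizedHGFunCoeff_add, ← hdesc, mul_assoc]
  rw [jacobiMoment, regularizedHGFunCoeff_cons_cons]
  push_cast [← Complex.Gamma_ofReal]
  rw [show (k + l + c : ℂ) = l + c + k by ring,
    ← ascPochhammer_eval_mul_Gamma hpole,
    show (k + l + l + c + 1 : ℂ) = 2 * l + c + 1 + k by ring]
  linear_combination ((ascPochhammer ℂ k).eval (l + c : ℂ) * Complex.Gamma (l + c) /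
    Complex.Gamma (2 * l + c + 1 + k)) * hcoeff

theorem hasSum_regularizedHGFunCoeff_mul_jacobiMoment {c : ℝ} (hc : 0 < c) {as bs : Multiset ℂ}
    (h : as.card ≤ bs.card) (t : ℂ) (l : ℕ) :
    HasSum (fun m ↦ regularizedHGFunCoeff as bs m * t ^ m * jacobiMoment c l m)
      (t ^ l * (as.map (ascPochhammer ℂ l).eval).prod * Complex.Gamma (l + c) *
        regularizedHGFun ((l + c : ℂ) ::ₘ as.map (· + (l : ℂ)))
          ((2 * l + c + 1 : ℂ) ::ₘ bs.map (· + (l : ℂ))) t) := by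
  have hlow : ∑ m ∈ Finset.range l,
      regularizedHGFunCoeff as bs m * t ^ m * (jacobiMoment c l m : ℂ) = 0 :=
    Finset.sum_eq_zero fun m hm ↦ by
      rw [jacobiMoment_eq_zero_of_lt c (Finset.mem_range.1 hm), Complex.ofReal_zero, mul_zero]
  rw [← hasSum_nat_add_iff' l, hlow, sub_zero]
  convert! (hasSum_regularizedHGFun (as := (l + c : ℂ) ::ₘ as.map (· + (l : ℂ)))
    (bs := (2 * l + c + 1 : ℂ) ::ₘ bs.map (· + (l : ℂ))) (by simpa using h) t).mul_left
      (t ^ l * (as.map (ascPochhammer ℂ l).eval).prod * Complex.Gamma (l + c)) using 2 with k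
  rw [pow_add]
  linear_combination t ^ k * t ^ l * regularizedHGFunCoeff_mul_jacobiMoment hc as bs l k

theorem hasSum_sq_regularizedHGFun {c : ℝ} (hc : 0 < c) {as bs : Multiset ℂ}
    (h : as.card ≤ bs.card) (t : ℂ) :
    HasSum (fun l : ℕ ↦ (2 * l + c : ℂ) *
        (t ^ l * (as.map (ascPochhammer ℂ l).eval).prod * Complex.Gamma (l + c) *
          regularizedHGFun ((l + c : ℂ) ::ₘ as.map (· + (l : ℂ)))
            ((2 * l + c + 1 : ℂ) ::ₘ bs.map (· + (l : ℂ))) t) ^ 2)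
      (∑' n : ℕ, (∑ p ∈ antidiagonal n,
        regularizedHGFunCoeff as bs p.1 * regularizedHGFunCoeff as bs p.2) * t ^ n / (n + c)) := by
  have hu := (hasSum_regularizedHGFun h t).summable
  convert! hasSum_tsum_mul_jacobiMoment_mul_tsum hc hu hu using 1
  · ext l
    rw [(hasSum_regularizedHGFunCoeff_mul_jacobiMoment hc h t l).tsum_eq, sq]
  · refine tsum_congr fun n ↦ congrArg (· / (n + c : ℂ)) ?_
    rw [Finset.sum_mul]
    refine Finset.sum_congr rfl fun p hp ↦ ?_
    rw [← Finset.HasAntidiagonal.mem_antidiagonal.1 hp, pow_add]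
    ring

end RegularizedHypergeometric

section TwoThree

theorem regularizedHGFunCoeff_zero_singleton_one (n : ℕ) :
    regularizedHGFunCoeff 0 {1} n = 1 / (n ! : ℂ) ^ 2 := by
  simp [regularizedHGFunCoeff, add_comm (1 : ℂ), Complex.Gamma_nat_eq_factorial, sq]

theorem sum_antidiagonal_one_div_factorial_sq {K : Type*} [Field K] [CharZero K] (n : ℕ) :
    ∑ p ∈ antidiagonal n, 1 / (p.1 ! : K) ^ 2 * (1 / (p.2 ! : K) ^ 2) =
      n.centralBinom / (n ! : K) ^ 2 := by
  rw [Nat.centralBinom_eq_two_mul_choose, ← Nat.sum_range_choose_sq,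
    ← Finset.Nat.sum_antidiagonal_eq_sum_range_succ_mk (fun p ↦ n.choose p.1 ^ 2), Nat.cast_sum,
    Finset.sum_div]
  refine Finset.sum_congr rfl fun p hp ↦ ?_
  have hn : (n ! : K) ≠ 0 := mod_cast n.factorial_ne_zero
  rw [Nat.cast_pow, ← Finset.HasAntidiagonal.mem_antidiagonal.1 hp, Nat.cast_add_choose,
    Finset.HasAntidiagonal.mem_antidiagonal.1 hp]
  field_simp

theorem pFq_one_half_eq_mul_tsum {c : ℂ} (hc : ∀ k : ℕ, c ≠ -k) (t : ℂ) :
    pFq {1 / 2, c} {1, 1, c + 1} (4 * t) =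
      c * ∑' n : ℕ, n.centralBinom / (n ! : ℂ) ^ 2 * t ^ n / (n + c) := by
  rw [pFq, ← tsum_mul_left]
  refine tsum_congr fun n ↦ ?_
  have hn : (n ! : ℂ) ≠ 0 := mod_cast n.factorial_ne_zero
  have hnc : (n : ℂ) + c ≠ 0 := fun h ↦ hc n (eq_neg_of_add_eq_zero_right h)
  have hpoch : (ascPochhammer ℂ n).eval (c + 1) ≠ 0 := fun h ↦ by
    obtain ⟨k, _, hk⟩ := (ascPochhammer_eval_eq_zero_iff n (c + 1)).1 h
    refine hc (k + 1) ?_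
    push_cast
    linear_combination hk
  have hshift : (ascPochhammer ℂ n).eval c * (n + c) = c * (ascPochhammer ℂ n).eval (c + 1) := by
    rw [add_comm, ascPochhammer_eval_mul_add_natCast]
  simp only [Multiset.insert_eq_cons, Multiset.map_cons, Multiset.map_singleton,
    Multiset.prod_cons, Multiset.prod_singleton, ascPochhammer_eval_one_half,
    ascPochhammer_eval_one, mul_pow]
  field_simp
  linear_combination (n.centralBinom * t ^ n : ℂ) * hshift

theorem hasSum_pFq_one_half {c : ℝ} (hc : 0 < c) (t : ℂ) :
    HasSum (fun l : ℕ ↦ c * (2 * l + c) * (t ^ l * Complex.Gamma (l + c) *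
        regularizedHGFun {(l : ℂ) + c} {2 * (l : ℂ) + c + 1, (l : ℂ) + 1} t) ^ 2)
      (pFq {1 / 2, (c : ℂ)} {1, 1, (c : ℂ) + 1} (4 * t)) := by
  have h := (hasSum_sq_regularizedHGFun (as := 0) (bs := {1}) hc (by simp) t).mul_left (c : ℂ)
  simp only [regularizedHGFunCoeff_zero_singleton_one,
    sum_antidiagonal_one_div_factorial_sq] at h
  rw [← pFq_one_half_eq_mul_tsum (ofReal_ne_neg_natCast hc)] at h
  convert! h using 2 with l
  simp only [Multiset.map_zero, Multiset.prod_zero, Multiset.map_singleton, mul_one,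
    Multiset.insert_eq_cons, add_comm (1 : ℂ), Multiset.cons_zero]
  ring

end TwoThree

section OddIndex

/-- The bijection `l ↦ 2l + 1` from the natural numbers to the odd ones, along which the expansion
over the degrees `l` becomes one over the odd `L`. -/
def natEquivOdd : ℕ ≃ {L : ℕ // Odd L} where
  toFun l := ⟨2 * l + 1, odd_two_mul_add_one l⟩
  invFun L := L / 2
  left_inv l := by simp only; omega
  right_inv L := by
    obtain ⟨L, l, rfl⟩ := L
    exact Subtype.ext (by simp only; omega)

theorem hasSum_odd_pFq_two_three (z : ℂ) :
    HasSum (fun L : {L : ℕ // Odd L} ↦ 3 / 2 * (((L : ℕ) : ℂ) + 1 / 2) * (z / 4) ^ ((L : ℕ) - 1) *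
        (Complex.Gamma (((L : ℕ) : ℂ) / 2 + 1) *
          regularizedHGFun {((L : ℕ) : ℂ) / 2 + 1}
            {((L : ℕ) : ℂ) + 3 / 2, ((L : ℕ) : ℂ) / 2 + 1 / 2} (z / 4)) ^ 2)
      (pFq {1 / 2, 3 / 2} {1, 1, 5 / 2} z) := by
  have h := hasSum_pFq_one_half (c := 3 / 2) (by norm_num) (z / 4)
  push_cast at h
  rw [mul_div_cancel₀ z (by norm_num : (4 : ℂ) ≠ 0), show (3 / 2 + 1 : ℂ) = 5 / 2 by norm_num] at h
  rw [← natEquivOdd.hasSum_iff]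
  convert! h using 2 with l
  simp only [Function.comp_apply, natEquivOdd, Equiv.coe_fn_mk, Nat.add_sub_cancel]
  rw [show ((2 * l + 1 : ℕ) : ℂ) / 2 + 1 = l + 3 / 2 by push_cast; ring,
    show ((2 * l + 1 : ℕ) : ℂ) / 2 + 1 / 2 = l + 1 by push_cast; ring,
    show ((2 * l + 1 : ℕ) : ℂ) + 3 / 2 = 2 * l + 3 / 2 + 1 by push_cast; ring,
    show ((2 * l + 1 : ℕ) : ℂ) + 1 / 2 = 2 * l + 3 / 2 by push_cast; ring]
  ring

theorem Gamma_add_one_div_Gamma_half_mul_sqrt_pi {s : ℂ} (hs : ∀ k : ℕ, s / 2 + 1 / 2 ≠ -k) :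
    Complex.Gamma (s + 1) / Complex.Gamma (s / 2 + 1 / 2) * (√Real.pi : ℂ) =
      2 ^ s * Complex.Gamma (s / 2 + 1) := by
  have h2 : (2 : ℂ) ^ s ≠ 0 := Complex.cpow_ne_zero_iff.2 (Or.inl two_ne_zero)
  have h := Complex.Gamma_mul_Gamma_add_half (s / 2 + 1 / 2)
  rw [show s / 2 + 1 / 2 + 1 / 2 = s / 2 + 1 by ring,
    show 2 * (s / 2 + 1 / 2) = s + 1 by ring, show 1 - (s + 1) = -s by ring,
    Complex.cpow_neg] at h
  rw [div_mul_eq_mul_div, div_eq_iff (Complex.Gamma_ne_zero hs), mul_assoc,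
    mul_comm (Complex.Gamma (s / 2 + 1)), h]
  field_simp

theorem add_one_half_mul_regularizedHGFun (s t : ℂ) :
    (s + 1 / 2) * regularizedHGFun {s / 2 + 1} {s + 3 / 2, s / 2 + 1 / 2} t =
      (s + 1) / 2 * t * regularizedHGFun {s / 2 + 1} {s + 5 / 2, s / 2 + 3 / 2} t +
        regularizedHGFun {s / 2} {s + 1 / 2, s / 2 + 1 / 2} t := by
  have h := regularizedHGFun_contiguous (s / 2) (s + 1 / 2) (as := 0) (bs := {s / 2 + 1 / 2})
    (by simp) t
  simp only [Multiset.map_zero, Multiset.prod_zero, Multiset.map_singleton, Multiset.cons_zero,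
    mul_one] at h
  rwa [show s + 1 / 2 + 1 = s + 3 / 2 by ring, show s + 1 / 2 + 2 = s + 5 / 2 by ring,
    show s / 2 + 1 / 2 + 1 = s / 2 + 3 / 2 by ring, show s + 1 / 2 - s / 2 = (s + 1) / 2 by ring]
    at h

theorem regularized_bracket_mul_sqrt_pi (L : ℕ) (z : ℂ) :
    ((L + 1) * Complex.Gamma (L + 2) / (16 * Complex.Gamma (L / 2 + 3 / 2)) * z *
          regularizedHGFun {(L : ℂ) / 2 + 1} {(L : ℂ) + 5 / 2, (L : ℂ) / 2 + 3 / 2} (z / 4) +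
        Complex.Gamma (L + 1) / Complex.Gamma (L / 2 + 1 / 2) *
          regularizedHGFun {(L : ℂ) / 2} {(L : ℂ) + 1 / 2, (L : ℂ) / 2 + 1 / 2} (z / 4)) *
        √Real.pi =
      2 ^ L * (L + 1 / 2) * (Complex.Gamma (L / 2 + 1) *
        regularizedHGFun {(L : ℂ) / 2 + 1} {(L : ℂ) + 3 / 2, (L : ℂ) / 2 + 1 / 2} (z / 4)) := by
  have hL : (L + 1 : ℂ) ≠ 0 := Nat.cast_add_one_ne_zero L
  have hpole : ∀ k : ℕ, (L / 2 + 1 / 2 : ℂ) ≠ -k := fun k ↦ by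
    simpa using ofReal_ne_neg_natCast (x := L / 2 + 1 / 2) (by positivity) k
  have hdup := Gamma_add_one_div_Gamma_half_mul_sqrt_pi hpole
  rw [Complex.cpow_natCast] at hdup
  have hL' : (L / 2 + 1 / 2 : ℂ) ≠ 0 := by simpa using hpole 0
  have hGamma : (L + 1) * Complex.Gamma (L + 2) / (16 * Complex.Gamma (L / 2 + 3 / 2)) =
      Complex.Gamma (L + 1) / Complex.Gamma (L / 2 + 1 / 2) * ((L + 1) / 8) := by
    rw [show (L + 2 : ℂ) = L + 1 + 1 by ring, Complex.Gamma_add_one _ hL,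
      show (L / 2 + 3 / 2 : ℂ) = L / 2 + 1 / 2 + 1 by ring, Complex.Gamma_add_one _ hL']
    field_simp
    ring
  rw [hGamma]
  linear_combination (L + 1 / 2) *
    regularizedHGFun {(L : ℂ) / 2 + 1} {(L : ℂ) + 3 / 2, (L : ℂ) / 2 + 1 / 2} (z / 4) * hdup -
    Complex.Gamma (L + 1) / Complex.Gamma (L / 2 + 1 / 2) * √Real.pi *
      add_one_half_mul_regularizedHGFun L (z / 4)

theorem choose_div_Gamma_mul_pFq (n : ℕ) (as : Multiset ℂ) {b : ℂ} (hb : ∀ k : ℕ, b ≠ -k)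
    (w : ℂ) :
    (2 * n).choose n / Complex.Gamma b * pFq as {(n : ℂ) + 1, b} w =
      Complex.Gamma (2 * n + 1) / Complex.Gamma (n + 1) *
        regularizedHGFun as {b, (n : ℂ) + 1} w := by
  have hG := Complex.Gamma_ne_zero hb
  have hn : ∀ k : ℕ, (n + 1 : ℂ) ≠ -k :=
    mod_cast ofReal_ne_neg_natCast (x := n + 1) (by positivity)
  have hfact : (n ! : ℂ) ≠ 0 := mod_cast n.factorial_ne_zero
  have h2n : Complex.Gamma (2 * n + 1) = (2 * n)! := mod_cast Complex.Gamma_nat_eq_factorial (2 * n)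
  rw [pFq_eq_prod_Gamma_mul_regularizedHGFun as (by simpa using ⟨hn, hb⟩), Multiset.pair_comm b,
    h2n, two_mul, Nat.cast_add_choose]
  simp only [Multiset.insert_eq_cons, Multiset.map_cons, Multiset.map_singleton,
    Multiset.prod_cons, Multiset.prod_singleton, Complex.Gamma_nat_eq_factorial]
  field_simp

theorem binomial_bracket_eq_regularized_bracket {L : ℕ} (hL : Odd L) (z : ℂ) :
    (L + 1) / (16 * Complex.Gamma ((2 * L + 5) / 2)) * (L + 1).choose ((L + 1) / 2) * z *
          pFq {(L : ℂ) / 2 + 1} {(L : ℂ) / 2 + 3 / 2, (L : ℂ) + 5 / 2} (z / 4) +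
        L / Complex.Gamma ((2 * L + 1) / 2) * (L - 1).choose ((L - 1) / 2) *
          pFq {(L : ℂ) / 2} {(L : ℂ) / 2 + 1 / 2, (L : ℂ) + 1 / 2} (z / 4) =
      (L + 1) * Complex.Gamma (L + 2) / (16 * Complex.Gamma (L / 2 + 3 / 2)) * z *
          regularizedHGFun {(L : ℂ) / 2 + 1} {(L : ℂ) + 5 / 2, (L : ℂ) / 2 + 3 / 2} (z / 4) +
        Complex.Gamma (L + 1) / Complex.Gamma (L / 2 + 1 / 2) *
          regularizedHGFun {(L : ℂ) / 2} {(L : ℂ) + 1 / 2, (L : ℂ) / 2 + 1 / 2} (z / 4) := by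
  obtain ⟨l, rfl⟩ := hL
  have h₁ := choose_div_Gamma_mul_pFq (l + 1) {(l : ℂ) + 3 / 2} (b := 2 * l + 7 / 2)
    (fun k ↦ by simpa using ofReal_ne_neg_natCast (x := 2 * l + 7 / 2) (by positivity) k) (z / 4)
  have h₀ := choose_div_Gamma_mul_pFq l {(l : ℂ) + 1 / 2} (b := 2 * l + 3 / 2)
    (fun k ↦ by simpa using ofReal_ne_neg_natCast (x := 2 * l + 3 / 2) (by positivity) k) (z / 4)
  have hL : ((2 * l + 1 : ℕ) : ℂ) ≠ 0 := Nat.cast_ne_zero.2 (by omega)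
  rw [Complex.Gamma_add_one _ hL, Nat.add_sub_cancel, show (2 * l + 1 + 1) / 2 = l + 1 by omega,
    show 2 * l / 2 = l by omega, show 2 * l + 1 + 1 = 2 * (l + 1) by ring,
    show ((2 * l + 1 : ℕ) : ℂ) / 2 + 1 = l + 3 / 2 by push_cast; ring,
    show ((2 * l + 1 : ℕ) : ℂ) / 2 + 3 / 2 = (l + 1 : ℕ) + 1 by push_cast; ring,
    show ((2 * l + 1 : ℕ) : ℂ) + 5 / 2 = 2 * l + 7 / 2 by push_cast; ring,
    show (2 * ((2 * l + 1 : ℕ) : ℂ) + 5) / 2 = 2 * l + 7 / 2 by push_cast; ring,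
    show (2 * ((2 * l + 1 : ℕ) : ℂ) + 1) / 2 = 2 * l + 3 / 2 by push_cast; ring,
    show ((2 * l + 1 : ℕ) : ℂ) / 2 + 1 / 2 = l + 1 by push_cast; ring,
    show ((2 * l + 1 : ℕ) : ℂ) + 1 / 2 = 2 * l + 3 / 2 by push_cast; ring,
    show ((2 * l + 1 : ℕ) : ℂ) / 2 = l + 1 / 2 by push_cast; ring,
    show ((2 * l + 1 : ℕ) : ℂ) + 2 = 2 * (l + 1 : ℕ) + 1 by push_cast; ring,
    show ((2 * l + 1 : ℕ) : ℂ) = 2 * l + 1 by push_cast; ring]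
  linear_combination (2 * l + 2) / 16 * z * h₁ + (2 * l + 1) * h₀

theorem prefactor_eq_of_odd {L : ℕ} (hL : Odd L) :
    (1 / 4 : ℂ) * Real.pi * (2 * 1 + 1) *
        ((-1 : ℂ) ^ (L - 1) * Complex.I ^ (2 * L - 2) * (2 : ℂ) ^ (2 - 4 * (L : ℤ)) *
          (1 + (-1 : ℂ) ^ (L + 1)) ^ 2 / (2 * L + 1)) =
      3 * Real.pi * 2 ^ (2 - 4 * (L : ℤ)) / (2 * L + 1) := by
  obtain ⟨l, rfl⟩ := hL
  have hI : Complex.I ^ (2 * (2 * l + 1) - 2) = 1 := by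
    rw [show 2 * (2 * l + 1) - 2 = 4 * l by omega, pow_mul, Complex.I_pow_four, one_pow]
  rw [Nat.add_sub_cancel, hI, (even_two_mul l).neg_one_pow,
    ((odd_two_mul_add_one l).add_one).neg_one_pow]
  ring

theorem prefactor_mul_sq_of_odd {L : ℕ} (hL : Odd L) {z B G : ℂ}
    (hB : B * √Real.pi = 2 ^ L * (L + 1 / 2) * G) :
    (1 / 4 : ℂ) * Real.pi * (2 * 1 + 1) *
        ((-1 : ℂ) ^ (L - 1) * Complex.I ^ (2 * L - 2) * (2 : ℂ) ^ (2 - 4 * (L : ℤ)) *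
          (1 + (-1 : ℂ) ^ (L + 1)) ^ 2 / (2 * L + 1)) * z ^ (L - 1) * B ^ 2 =
      3 / 2 * (L + 1 / 2) * (z / 4) ^ (L - 1) * G ^ 2 := by
  have hsq : (Real.pi : ℂ) = (√Real.pi : ℂ) ^ 2 := by
    rw [← Complex.ofReal_pow, Real.sq_sqrt Real.pi_pos.le]
  have hL₀ : (2 * L + 1 : ℂ) ≠ 0 := mod_cast (2 * L).succ_ne_zero
  have hpow : (2 : ℂ) ^ (2 - 4 * (L : ℤ)) * (2 ^ L) ^ 2 = (4 ^ (L - 1))⁻¹ := by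
    rw [show (4 : ℂ) = 2 ^ 2 by norm_num, ← pow_mul, ← pow_mul, ← zpow_natCast, ← zpow_natCast,
      ← zpow_neg, ← zpow_add₀ two_ne_zero]
    congr 1
    have := hL.pos
    omega
  rw [prefactor_eq_of_odd hL]
  calc
    3 * Real.pi * (2 : ℂ) ^ (2 - 4 * (L : ℤ)) / (2 * L + 1) * z ^ (L - 1) * B ^ 2
    _ = 3 * 2 ^ (2 - 4 * (L : ℤ)) / (2 * L + 1) * z ^ (L - 1) * (B * √Real.pi) ^ 2 := by
      rw [hsq]
      ring
    _ = 3 * (2 ^ (2 - 4 * (L : ℤ)) * (2 ^ L) ^ 2) / (2 * L + 1) * z ^ (L - 1) *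
        (L + 1 / 2) ^ 2 * G ^ 2 := by
      rw [hB]
      ring
    _ = 3 / 2 * (L + 1 / 2) * (z / 4) ^ (L - 1) * G ^ 2 := by
      rw [hpow, div_pow]
      field_simp

end OddIndex

theorem mainTheorem4 (z : ℂ) :
    HasSum
      (fun L : {L : ℕ // Odd L} =>
        (1 / 4 : ℂ) * (Real.pi : ℂ) * (2 * 1 + 1) *
          ((-1 : ℂ) ^ ((L : ℕ) - 1) * Complex.I ^ (2 * (L : ℕ) - 2) *
              (2 : ℂ) ^ (2 - 4 * ((L : ℕ) : ℤ)) * (1 + (-1 : ℂ) ^ ((L : ℕ) + 1)) ^ 2 /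
            (2 * ((L : ℕ) : ℂ) + 1)) *
          z ^ ((L : ℕ) - 1) *
          ((((L : ℕ) : ℂ) + 1) / (16 * Complex.Gamma ((2 * ((L : ℕ) : ℂ) + 5) / 2)) *
              (Nat.choose ((L : ℕ) + 1) (((L : ℕ) + 1) / 2) : ℂ) * z *
              pFq {((L : ℕ) : ℂ) / 2 + 1}
                {((L : ℕ) : ℂ) / 2 + 3 / 2, ((L : ℕ) : ℂ) + 5 / 2} (z / 4) +
            ((L : ℕ) : ℂ) / Complex.Gamma ((2 * ((L : ℕ) : ℂ) + 1) / 2) *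
              (Nat.choose ((L : ℕ) - 1) (((L : ℕ) - 1) / 2) : ℂ) *
              pFq {((L : ℕ) : ℂ) / 2}
                {((L : ℕ) : ℂ) / 2 + 1 / 2, ((L : ℕ) : ℂ) + 1 / 2} (z / 4)) ^ 2)
      (pFq {1 / 2, 3 / 2} {1, 1, 5 / 2} z) ∧
    HasSum
      (fun L : {L : ℕ // Odd L} =>
        (1 / 4 : ℂ) * (Real.pi : ℂ) * (2 * 1 + 1) *
          ((-1 : ℂ) ^ ((L : ℕ) - 1) * Complex.I ^ (2 * (L : ℕ) - 2) *
              (2 : ℂ) ^ (2 - 4 * ((L : ℕ) : ℤ)) * (1 + (-1 : ℂ) ^ ((L : ℕ) + 1)) ^ 2 /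
            (2 * ((L : ℕ) : ℂ) + 1)) *
          z ^ ((L : ℕ) - 1) *
          ((((L : ℕ) : ℂ) + 1) * Complex.Gamma (((L : ℕ) : ℂ) + 2) /
                (16 * Complex.Gamma (((L : ℕ) : ℂ) / 2 + 3 / 2)) * z *
              Complex.regularizedHGFun {((L : ℕ) : ℂ) / 2 + 1}
                {((L : ℕ) : ℂ) + 5 / 2, ((L : ℕ) : ℂ) / 2 + 3 / 2} (z / 4) +
            Complex.Gamma (((L : ℕ) : ℂ) + 1) / Complex.Gamma (((L : ℕ) : ℂ) / 2 + 1 / 2) *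
              Complex.regularizedHGFun {((L : ℕ) : ℂ) / 2}
                {((L : ℕ) : ℂ) + 1 / 2, ((L : ℕ) : ℂ) / 2 + 1 / 2} (z / 4)) ^ 2)
      (pFq {1 / 2, 3 / 2} {1, 1, 5 / 2} z) := by
  have second := hasSum_odd_pFq_two_three z
  simp only [← prefactor_mul_sq_of_odd (Subtype.property _) (regularized_bracket_mul_sqrt_pi _ z)]
    at second
  refine ⟨?_, second⟩
  simpa only [binomial_bracket_eq_regularized_bracket (Subtype.property _) z] using second
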